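/- Let $\mathcal X,\mathcal Y_1,\mathcal Y_2,\mathcal Z$ be finite sets with $|\mathcal X|\ge 2$, and let $P_{Y_1|X},P_{Y_2|X},P_{Z|X}$ be channels with common input alphabet $\mathcal X$ (two users and a warden). Let $x_0\in\mathcal X$ be the zero symbol and $Q_0=P_{Z|X}(\cdot|x_0)$. Assume that $Q_0$ is not in the convex hull of $\{P_{Z|X}(\cdot|x'):x'\ne x_0\}$, and that $P_{Z|X}(\cdot|x)\ll Q_0$ and $P_{Y_k|X}(\cdot|x)\ll P_{Y_k|X}(\cdot|x_0)$ for all $x\in\mathcal X$, $k=1,2$. All logarithms are natural. Fix $\delta>0$. *Covert capacities.* For $k\in\{1,2\}$, an $(n,\nu,\epsilon,\delta)$ covert code for $P_{Y_k|X}$ consists of a secret key $S$ with some distribution on a finite set $\mathcal S$, an encoder $f:[1:\nu]\times\mathcal S\to\mathcal X^n$ and a decoder $\phi:\mathcal Y_k^n\times\mathcal S\to[1:\nu]$ such that, for a uniform message independent of $S$ and memoryless channels, the average error probability is at most $\epsilon$ and the induced law of the warden's output satisfies $D(P_{Z^n}\|Q_0^{\times n})\le\delta$. A rate $L\ge0$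 is $\delta$-achievable if for all $\epsilon,\rho>0$ and all sufficiently large $n$ there is an $(n,\nu,\epsilon,\delta)$ covert code with $\nu\ge e^{\sqrt{n\delta}(L-\rho)}$. The covert capacity $L_k^*$ is the supremum of the $\delta$-achievable rates. *Time-sharing region.* $\mathcal L^{(\mathrm{TS})}=\{(L_1,L_2): L_1,L_2\ge0,\ L_1/L_1^*+L_2/L_2^*\le1\}$ (if $L_k^*=0$, this is read as requiring $L_k=0$ and dropping the $k$-th term). *Region.* For pmfs $P$ and $Q$ with $P\ll Q$ let $\chi_2(P\|Q)=\sum_z (P(z)-Q(z))^2/Q(z)$, the sum over $z$ with $Q(z)>0$. The computable region $\tilde{\mathcal L}^{(I)}$ consists of all pairs $(L_1,L_2)$ with $L_1,L_2\ge 0$ for which there are $\nu\in[0,1]$, an alphabet $\mathcal U$ with $|\mathcal U|\le|\mathcal X|+1$, a point $u_0\in\mathcal U$ with $B=\mathcal U\setminus\{u_0\}$, a pmf $\tilde P_X^A$ on $\mathcal X\setminus\{x_0\}$ and a pmf $P_{UX}^B$ on $B\times\mathcal X$ such that $\chi_2(\nu):=\chi_2\big((1-\nu)\tilde P_Z^A+\nu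 P_Z^B\,\|\,Q_0\big)>0$ and $$L_1\le\sqrt{\tfrac{2}{\chi_2(\nu)}}\Big[(1-\nu)\sum_x\tilde P_X^A(x)\,D\big(P_{Y_1|X}(\cdot|x)\|P_{Y_1|X}(\cdot|x_0)\big)+\nu\, I^B(X;Y_1|U)\Big],$$ $$L_2\le\sqrt{\tfrac{2}{\chi_2(\nu)}}\Big[\nu\sum_x P_X^B(x)\,D\big(P_{Y_2|X}(\cdot|x)\|P_{Y_2|X}(\cdot|x_0)\big)-\nu\, I^B(X;Y_2|U)\Big].$$ Here $\tilde P_Z^A$ and $P_Z^B$ are the outputs of $P_{Z|X}$ under $\tilde P_X^A$ and the marginal $P_X^B$, and $I^B$ is computed under $P^B_{UX}P_{Y_k|X}$. Then $\mathcal L^{(\mathrm{TS})}\subseteq\tilde{\mathcal L}^{(I)}$. -/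

import Mathlib

open scoped ENNReal NNReal

namespace CovertBC

noncomputable section

/-! Finite-alphabet probability. A pmf on a finite type `α` is an element of `stdSimplex ℝ α`.
All logarithms are natural. -/

/-- `W x y = W(y|x)` is a transition probability matrix. -/
def IsChannel {X Y : Type*} [Fintype Y] (W : X → Y → ℝ) : Prop :=
  ∀ x, W x ∈ stdSimplex ℝ Y

/-- The output distribution `p ∘ W`. -/
def output {X Y : Type*} [Fintype X] (p : X → ℝ) (W : X → Y → ℝ) : Y → ℝ :=
  fun y => ∑ x, p x * W x y

/-- Absolute continuity `p ≪ q`. -/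
def AbsCont {Y : Type*} (p q : Y → ℝ) : Prop :=
  ∀ y, q y = 0 → p y = 0

/-- Relative entropy `D(p ‖ q)` for `p ≪ q` (with `0 log 0 = 0`). It is used only for pairs with
`p ≪ q`; otherwise the divergence is infinite and this real number has no meaning. -/
def relEntropy {Y : Type*} [Fintype Y] (p q : Y → ℝ) : ℝ :=
  ∑ y, p y * Real.log (p y / q y)

/-- The `χ₂`-distance for `p ≪ q` (terms with `q z = 0`, and hence `p z = 0`, contribute `0`). -/
def chiSq {Z : Type*} [Fintype Z] (p q : Z → ℝ) : ℝ :=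
  ∑ z, (p z - q z) ^ 2 / q z

/-- Conditional mutual information `I(X; Y | U)` when `(U, X)` has pmf `P` and `Y` is the output of
the channel `W` with input `X` (so that `U - X - Y` is a Markov chain):
`∑ P(u,x,y) log (P(u,x,y) P(u) / (P(u,x) P(u,y)))`. -/
def condMutualInfo {U X Y : Type*} [Fintype U] [Fintype X] [Fintype Y]
    (P : U × X → ℝ) (W : X → Y → ℝ) : ℝ :=
  ∑ u, ∑ x, ∑ y, P (u, x) * W x y *
    Real.log ((P (u, x) * W x y) * (∑ x', P (u, x')) /
      (P (u, x) * ∑ x', P (u, x') * W x' y))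

/-- The `n`-fold memoryless extension `Wⁿ(yⁿ|xⁿ)`. -/
def memoryless {X Y : Type*} (W : X → Y → ℝ) {n : ℕ} (x : Fin n → X) (y : Fin n → Y) : ℝ :=
  ∏ i, W (x i) (y i)

/-! Covert codes and covert capacity of a discrete memoryless channel with a warden. -/

/-- A code of blocklength `n` with `ν` messages and a secret key, of arbitrary distribution on a
finite set, that is shared by encoder and decoder. -/
structure Code (X Y : Type*) (n ν : ℕ) where
  /-- The number of key values. -/
  κ : ℕ
  /-- The distribution of the key. -/
  keyDist : Fin κ → ℝ
  keyDist_mem : keyDist ∈ stdSimplex ℝ (Fin κ)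
  /-- The encoder. -/
  enc : Fin ν → Fin κ → Fin n → X
  /-- The decoder. -/
  dec : (Fin n → Y) → Fin κ → Fin ν

/-- Error probability, averaged over uniform messages and over the key. -/
def Code.errorProb {X Y : Type*} [Fintype Y] {n ν : ℕ} (c : Code X Y n ν) (W : X → Y → ℝ) : ℝ :=
  (1 / (ν : ℝ)) * ∑ m, ∑ s, c.keyDist s *
    ∑ y with c.dec y s ≠ m, memoryless W (c.enc m s) y

/-- Distribution of the warden's output `Zⁿ` that the code induces over the warden's channel `V`. -/
def Code.wardenDist {X Y Z : Type*} {n ν : ℕ} (c : Code X Y n ν) (V : X → Z → ℝ) :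
    (Fin n → Z) → ℝ :=
  fun z => (1 / (ν : ℝ)) * ∑ m, ∑ s, c.keyDist s * memoryless V (c.enc m s) z

/-- `c` is an `(n, ν, ε, δ)` covert code: its error probability is at most `ε`, and
`D(P_{Zⁿ} ‖ Q₀ⁿ) ≤ δ`, where `Q₀ = V x₀` (a finite divergence includes `P_{Zⁿ} ≪ Q₀ⁿ`). -/
def Code.IsCovert {X Y Z : Type*} [Fintype Y] [Fintype Z] {n ν : ℕ} (c : Code X Y n ν)
    (W : X → Y → ℝ) (V : X → Z → ℝ) (x₀ : X) (ε δ : ℝ) : Prop :=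
  c.errorProb W ≤ ε ∧
  AbsCont (c.wardenDist V) (memoryless V fun _ : Fin n => x₀) ∧
  relEntropy (c.wardenDist V) (memoryless V fun _ : Fin n => x₀) ≤ δ

/-- The covert rate `L` (natural units, normalisation `log ν / √(n δ)`) is `δ`-achievable over the
channel `W` with warden's channel `V` and zero symbol `x₀`. -/
def IsAchievableRate {X Y Z : Type*} [Fintype Y] [Fintype Z]
    (W : X → Y → ℝ) (V : X → Z → ℝ) (x₀ : X) (δ L : ℝ) : Prop :=
  ∀ ε > 0, ∀ ρ > 0, ∀ᶠ n : ℕ in Filter.atTop, ∃ ν : ℕ,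
    Real.exp (Real.sqrt (n * δ) * (L - ρ)) ≤ ν ∧
    ∃ c : Code X Y n ν, c.IsCovert W V x₀ ε δ

/-- The covert capacity `L*`: the supremum of the nonnegative `δ`-achievable covert rates. -/
def covertCapacity {X Y Z : Type*} [Fintype Y] [Fintype Z]
    (W : X → Y → ℝ) (V : X → Z → ℝ) (x₀ : X) (δ : ℝ) : ℝ≥0∞ :=
  ⨆ (L : ℝ≥0) (_ : IsAchievableRate W V x₀ δ L), (L : ℝ≥0∞)

/-! The broadcast channel with a warden, given by its three marginal channels. -/

/-- The standing conditions on a broadcast channel `(W₁, W₂)` with warden's channel `V`. -/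
structure CovertConditions {X Y₁ Y₂ Z : Type*}
    (W₁ : X → Y₁ → ℝ) (W₂ : X → Y₂ → ℝ) (V : X → Z → ℝ) (x₀ : X) : Prop where
  /-- The zero symbol is not redundant at the warden. -/
  nonredundant : V x₀ ∉ convexHull ℝ (V '' {x | x ≠ x₀})
  /-- Absolute continuity at the warden. -/
  absCont_warden : ∀ x, AbsCont (V x) (V x₀)
  /-- Absolute continuity at user 1. -/
  absCont_user₁ : ∀ x, AbsCont (W₁ x) (W₁ x₀)
  /-- Absolute continuity at user 2. -/
  absCont_user₂ : ∀ x, AbsCont (W₂ x) (W₂ x₀)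

/-- The time-sharing region: nonnegative pairs with `L₁ / L₁* + L₂ / L₂* ≤ 1`. The quotients are
taken in `[0, ∞]`, where `0 / 0 = 0` and `a / 0 = ∞` for `a > 0`: if `L_k* = 0`, then `L_k = 0`. -/
def timeSharingRegion (L₁s L₂s : ℝ≥0∞) : Set (ℝ × ℝ) :=
  {L | 0 ≤ L.1 ∧ 0 ≤ L.2 ∧ ENNReal.ofReal L.1 / L₁s + ENNReal.ofReal L.2 / L₂s ≤ 1}

/-- `χ₂(ν) = χ₂((1 - ν) P̃_Z^A + ν P_Z^B ‖ Q₀)`, for a pmf `PA` on `X \ {x₀}` and a pmf `PB` on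
`B × X`. -/
def chiMix {X Z B : Type*} [Fintype X] [DecidableEq X] [Fintype Z] [Fintype B]
    (V : X → Z → ℝ) (x₀ : X) (PA : {x : X // x ≠ x₀} → ℝ) (PB : B × X → ℝ) (ν : ℝ) : ℝ :=
  chiSq (fun z => (1 - ν) * output PA (fun x => V x) z + ν * output (fun x => ∑ u, PB (u, x)) V z)
    (V x₀)

/-- The computable region. The auxiliary alphabet is `U = Fin k` with `k ≤ |X| + 1`,
`A = {u₀}` and `B = U \ {u₀}`; `PA` is the pmf `P̃_X^A` on `X \ {x₀}` and `PB` the pmf `P_{UX}^B` on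
`B × X`. The condition `0 < χ₂(ν)` makes the factor `√(2 / χ₂(ν))` meaningful. -/
def computableRegion {X Y₁ Y₂ Z : Type*} [Fintype X] [DecidableEq X] [Fintype Y₁] [Fintype Y₂]
    [Fintype Z] (W₁ : X → Y₁ → ℝ) (W₂ : X → Y₂ → ℝ) (V : X → Z → ℝ) (x₀ : X) : Set (ℝ × ℝ) :=
  {L | 0 ≤ L.1 ∧ 0 ≤ L.2 ∧
    ∃ ν ∈ Set.Icc (0 : ℝ) 1, ∃ k : ℕ, k ≤ Fintype.card X + 1 ∧ ∃ u₀ : Fin k,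
    ∃ PA ∈ stdSimplex ℝ {x : X // x ≠ x₀}, ∃ PB ∈ stdSimplex ℝ ({u : Fin k // u ≠ u₀} × X),
      0 < chiMix V x₀ PA PB ν ∧
      L.1 ≤ Real.sqrt (2 / chiMix V x₀ PA PB ν) *
        ((1 - ν) * ∑ x, PA x * relEntropy (W₁ x) (W₁ x₀) + ν * condMutualInfo PB W₁) ∧
      L.2 ≤ Real.sqrt (2 / chiMix V x₀ PA PB ν) *
        (ν * ∑ x, (∑ u, PB (u, x)) * relEntropy (W₂ x) (W₂ x₀) - ν * condMutualInfo PB W₂)}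

end

end CovertBC

namespace CovertBC

/-! Variational bounds for the relative entropy. -/

/-! The time-sharing region grows with both capacities, so upper bounds on them suffice: by
`covertCapacity_le`, each is at most the maximum over `P` of `covertRate`, i.e. √(2/χ₂) times the
mean divergence. Achievability of the capacities plays no role.

Converse: reliable decoding forces the expected letter counts `N` to carry divergence of about log ν
(`Code.log_card_le`). Covertness limits `N`: Donsker–Varadhan with additive test functions gives
linear inequalities in `N` (`Code.sum_letterCount_mul_le`). A tilt of order n^(-1/2) along the
relative deviation of the warden's output turns these into the covert rate, up to an error bounded
in n (`sum_mul_relEntropy_le_of_covert`).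

Inclusion: let `P₁`, `P₂` maximise the two covert rates. Taking U to be a copy of X on `B` kills the
conditional information. Since √χ₂ satisfies Minkowski's inequality (`chiSq_mix_le`), a suitable ν
gives each user at least its time-shared rate (`mem_computableRegion_of_timeSharing`). -/

theorem sum_mul_add_sum_sub_le_relEntropy {Y : Type*} [Fintype Y] {p q : Y → ℝ}
    (hp : ∀ y, 0 ≤ p y) (hq : ∀ y, 0 ≤ q y) (hpq : AbsCont p q) (f : Y → ℝ) :
    ∑ y, p y * f y + ∑ y, p y - ∑ y, q y * Real.exp (f y) ≤ relEntropy p q := by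
  unfold relEntropy
  rw [← Finset.sum_add_distrib, ← Finset.sum_sub_distrib]
  refine Finset.sum_le_sum fun y _ => ?_
  rcases (hp y).eq_or_lt with h0 | hpos
  · rw [← h0]
    have := mul_nonneg (hq y) (Real.exp_pos (f y)).le
    simp only [zero_mul, zero_add]
    linarith
  · have hqpos : 0 < q y := (hq y).lt_of_ne fun h => hpos.ne' (hpq y h.symm)
    -- The inequality log u ≤ u - 1 at u = q e^f / p, weighted by p.
    have h1 := Real.log_le_sub_one_of_pos
      (div_pos (mul_pos hqpos (Real.exp_pos (f y))) hpos)
    rw [Real.log_div (by positivity) hpos.ne', Real.log_mul hqpos.ne' (Real.exp_pos _).ne',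
      Real.log_exp] at h1
    rw [Real.log_div hpos.ne' hqpos.ne']
    have h2 := mul_le_mul_of_nonneg_left h1 hpos.le
    have h3 : p y * (q y * Real.exp (f y) / p y - 1) = q y * Real.exp (f y) - p y := by
      field_simp
    linarith

theorem relEntropy_nonneg {Y : Type*} [Fintype Y] {p q : Y → ℝ}
    (hp : p ∈ stdSimplex ℝ Y) (hq : q ∈ stdSimplex ℝ Y) (hpq : AbsCont p q) :
    0 ≤ relEntropy p q := by
  have h := sum_mul_add_sum_sub_le_relEntropy hp.1 hq.1 hpq fun _ => 0
  simpa [hp.2, hq.2] using h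

theorem sum_mul_exp_pos {Y : Type*} [Fintype Y] {q : Y → ℝ} (hq : q ∈ stdSimplex ℝ Y) (f : Y → ℝ) :
    0 < ∑ y, q y * Real.exp (f y) := by
  have hex : ∃ y ∈ Finset.univ, 0 < q y := by
    by_contra! h
    have := Finset.sum_nonpos h
    rw [hq.2] at this
    linarith
  obtain ⟨y, hy, hqy⟩ := hex
  exact Finset.sum_pos' (fun z _ => mul_nonneg (hq.1 z) (Real.exp_pos _).le)
    ⟨y, hy, mul_pos hqy (Real.exp_pos _)⟩

/-- The Donsker–Varadhan bound. -/
theorem sum_mul_le_relEntropy_add_log {Y : Type*} [Fintype Y] {p q : Y → ℝ}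
    (hp : p ∈ stdSimplex ℝ Y) (hq : q ∈ stdSimplex ℝ Y) (hpq : AbsCont p q) (f : Y → ℝ) :
    ∑ y, p y * f y ≤ relEntropy p q + Real.log (∑ y, q y * Real.exp (f y)) := by
  set S := ∑ y, q y * Real.exp (f y) with hS
  have hSpos : 0 < S := sum_mul_exp_pos hq f
  -- Shifting f by log S normalises the tilted law q e^f to mass one.
  have h := sum_mul_add_sum_sub_le_relEntropy hp.1 hq.1 hpq fun y => f y - Real.log S
  simp only [Real.exp_sub, Real.exp_log hSpos, mul_sub, Finset.sum_sub_distrib, ← mul_div_assoc,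
    ← Finset.sum_div, ← Finset.sum_mul, hp.2] at h
  rw [← hS, div_self hSpos.ne'] at h
  linarith

/-! Memoryless extensions. -/

theorem memoryless_absCont {X Y : Type*} {n : ℕ} {W : X → Y → ℝ} {x₀ : X}
    (hW : ∀ x, AbsCont (W x) (W x₀)) (x : Fin n → X) :
    AbsCont (memoryless W x) (memoryless W fun _ => x₀) := by
  intro y hy
  obtain ⟨i, hi, h⟩ := Finset.prod_eq_zero_iff.1 hy
  exact Finset.prod_eq_zero hi (hW (x i) (y i) h)

section memoryless

variable {X Y : Type*} [Fintype Y] {n : ℕ} {W : X → Y → ℝ}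

theorem memoryless_nonneg (hW : IsChannel W) (x : Fin n → X) (y : Fin n → Y) :
    0 ≤ memoryless W x y :=
  Finset.prod_nonneg fun i _ => (hW (x i)).1 (y i)

theorem sum_prod_apply (g : Fin n → Y → ℝ) : ∑ y : Fin n → Y, ∏ i, g i (y i) = ∏ i, ∑ b, g i b := by
  classical
  rw [Finset.prod_univ_sum, Fintype.piFinset_univ]

theorem memoryless_mem (hW : IsChannel W) (x : Fin n → X) :
    memoryless W x ∈ stdSimplex ℝ (Fin n → Y) := by
  refine ⟨memoryless_nonneg hW x, ?_⟩
  unfold memoryless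
  rw [sum_prod_apply fun i => W (x i)]
  exact Finset.prod_eq_one fun i _ => (hW (x i)).2

theorem sum_memoryless_mul_sum (hW : IsChannel W) (x : Fin n → X) (g : Fin n → Y → ℝ) :
    ∑ y, memoryless W x y * ∑ j, g j (y j) = ∑ j, ∑ b, W (x j) b * g j b := by
  simp only [Finset.mul_sum]
  rw [Finset.sum_comm]
  refine Finset.sum_congr rfl fun j _ => ?_
  -- Padding with factors 1 off coordinate j keeps the summand a product, so the sum factorises.
  have h (y : Fin n → Y) : memoryless W x y * g j (y j) =
      ∏ i, W (x i) (y i) * (if i = j then g j (y i) else 1) := by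
    rw [Finset.prod_mul_distrib, Finset.prod_ite_eq' Finset.univ j, if_pos (Finset.mem_univ j)]
    rfl
  simp only [h]
  rw [sum_prod_apply fun i b => W (x i) b * (if i = j then g j b else 1),
    Finset.prod_eq_single j]
  · simp
  · intro i _ hij
    simpa [hij] using (hW (x i)).2
  · simp

theorem relEntropy_memoryless (hW : IsChannel W) {x₀ : X} (hac : ∀ x, AbsCont (W x) (W x₀))
    (x : Fin n → X) :
    relEntropy (memoryless W x) (memoryless W fun _ => x₀) =
      ∑ i, relEntropy (W (x i)) (W x₀) := by
  have h := sum_memoryless_mul_sum hW x fun i b => Real.log (W (x i) b / W x₀ b)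
  unfold relEntropy
  rw [← h]
  refine Finset.sum_congr rfl fun y _ => ?_
  by_cases hy : memoryless W x y = 0
  · simp [hy]
  · have h1 (i : Fin n) : W (x i) (y i) ≠ 0 := fun h => hy (Finset.prod_eq_zero (Finset.mem_univ i) h)
    rw [← Real.log_prod fun i _ => div_ne_zero (h1 i) fun h => h1 i (hac _ _ h),
      Finset.prod_div_distrib]
    rfl

end memoryless

/-! Codes. -/

section Code

variable {X Y Z : Type*} {n ν : ℕ}

/-- The expectation of `∑ i, φ (Xᵢ)` over the codewords. -/
noncomputable def Code.expSum (c : Code X Y n ν) (φ : X → ℝ) : ℝ :=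
  (1 / (ν : ℝ)) * ∑ m, ∑ s, c.keyDist s * ∑ i, φ (c.enc m s i)

theorem Code.sum_average_mul {ι : Type*} [Fintype ι] (c : Code X Y n ν)
    (g : ι → Fin ν → Fin c.κ → ℝ) (b : ι → ℝ) :
    ∑ i, ((1 / (ν : ℝ)) * ∑ m, ∑ s, c.keyDist s * g i m s) * b i =
      (1 / (ν : ℝ)) * ∑ m, ∑ s, c.keyDist s * ∑ i, g i m s * b i := by
  simp only [Finset.mul_sum, Finset.sum_mul]
  rw [Finset.sum_comm]
  refine Finset.sum_congr rfl fun m _ => ?_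
  rw [Finset.sum_comm]
  exact Finset.sum_congr rfl fun s _ => Finset.sum_congr rfl fun i _ => by ring

/-- The expected number of occurrences of a letter in the codewords. -/
noncomputable def Code.letterCount [DecidableEq X] (c : Code X Y n ν) (x : X) : ℝ :=
  c.expSum fun x' => if x' = x then 1 else 0

theorem Code.expSum_eq_sum_letterCount [Fintype X] [DecidableEq X] (c : Code X Y n ν)
    (φ : X → ℝ) : c.expSum φ = ∑ x, c.letterCount x * φ x := by
  unfold Code.letterCount Code.expSum
  rw [c.sum_average_mul]
  refine congrArg _ (Finset.sum_congr rfl fun m _ => Finset.sum_congr rfl fun s _ =>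
    congrArg _ ?_)
  simp only [Finset.sum_mul]
  rw [Finset.sum_comm]
  simp

theorem Code.letterCount_nonneg [DecidableEq X] (c : Code X Y n ν) (x : X) :
    0 ≤ c.letterCount x := by
  refine mul_nonneg (by positivity) (Finset.sum_nonneg fun m _ => Finset.sum_nonneg fun s _ =>
    mul_nonneg (c.keyDist_mem.1 s) (Finset.sum_nonneg fun i _ => ?_))
  dsimp only
  split_ifs <;> norm_num

theorem Code.average_const (c : Code X Y n ν) (hν : 0 < ν) (a : ℝ) :
    (1 / (ν : ℝ)) * ∑ _m : Fin ν, ∑ s, c.keyDist s * a = a := by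
  rw [← Finset.sum_mul, c.keyDist_mem.2]
  simp
  field_simp

theorem Code.wardenDist_mem [Fintype Z] (c : Code X Y n ν) (hν : 0 < ν) {V : X → Z → ℝ}
    (hV : IsChannel V) : c.wardenDist V ∈ stdSimplex ℝ (Fin n → Z) := by
  refine ⟨fun z => mul_nonneg (by positivity) (Finset.sum_nonneg fun m _ => Finset.sum_nonneg
    fun s _ => mul_nonneg (c.keyDist_mem.1 s) (memoryless_nonneg hV _ _)), ?_⟩
  have h := c.sum_average_mul (fun z m s => memoryless V (c.enc m s) z) fun _ => 1
  simp only [mul_one, (memoryless_mem hV _).2] at h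
  have h' := c.average_const hν 1
  simp only [mul_one] at h'
  exact h.trans h'

/-- The covertness constraint limits the expected letter counts. -/
theorem Code.sum_letterCount_mul_le [Fintype X] [DecidableEq X] [Fintype Z] (c : Code X Y n ν)
    (hν : 0 < ν) {V : X → Z → ℝ} (hV : IsChannel V) {x₀ : X}
    (hac : AbsCont (c.wardenDist V) (memoryless V fun _ : Fin n => x₀)) (h : Z → ℝ) :
    ∑ x, c.letterCount x * ∑ z, V x z * h z ≤
      relEntropy (c.wardenDist V) (memoryless V fun _ : Fin n => x₀) +
        n * Real.log (∑ z, V x₀ z * Real.exp (h z)) := by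
  -- For an additive test function the reference moment is an n-th power, and the mean under the
  -- code depends only on letter counts.
  have key := sum_mul_le_relEntropy_add_log (c.wardenDist_mem hν hV)
    (memoryless_mem hV fun _ : Fin n => x₀) hac fun z => ∑ i, h (z i)
  have h1 : ∑ z, memoryless V (fun _ : Fin n => x₀) z * Real.exp (∑ i, h (z i)) =
      (∑ z, V x₀ z * Real.exp (h z)) ^ n := by
    unfold memoryless
    simp only [Real.exp_sum, ← Finset.prod_mul_distrib]
    rw [sum_prod_apply fun _ b => V x₀ b * Real.exp (h b)]
    simp
  have h2 : ∑ z, c.wardenDist V z * ∑ i, h (z i) =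
      ∑ x, c.letterCount x * ∑ z, V x z * h z := by
    rw [← c.expSum_eq_sum_letterCount fun x => ∑ z, V x z * h z]
    unfold Code.wardenDist Code.expSum
    rw [c.sum_average_mul]
    simp only [sum_memoryless_mul_sum hV _ fun _ => h]
  rwa [h1, h2, Real.log_pow] at key

/-- A Fano-type converse with the reference law `Wⁿ(·|x₀,…,x₀)`. -/
theorem Code.log_card_le [Fintype X] [DecidableEq X] [Fintype Y] (c : Code X Y n ν)
    (hν : 0 < ν) {W : X → Y → ℝ} (hW : IsChannel W) {x₀ : X}
    (hac : ∀ x, AbsCont (W x) (W x₀)) :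
    (1 - c.errorProb W) * Real.log ν - 1 ≤
      ∑ x, c.letterCount x * relEntropy (W x) (W x₀) := by
  have hν' : (0 : ℝ) < ν := by exact_mod_cast hν
  have hν1 : (1 : ℝ) ≤ ν := by exact_mod_cast hν
  rw [← c.expSum_eq_sum_letterCount fun x => relEntropy (W x) (W x₀)]
  set q := memoryless W fun _ : Fin n => x₀ with hq
  have hqm := memoryless_mem hW fun _ : Fin n => x₀
  rw [← hq] at hqm
  have h1 (m : Fin ν) (s : Fin c.κ) :
      (1 - ∑ y with c.dec y s ≠ m, memoryless W (c.enc m s) y) * Real.log ν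
        - ν * (∑ y with c.dec y s = m, q y) ≤
      ∑ i, relEntropy (W (c.enc m s i)) (W x₀) := by
    have hp := memoryless_mem hW (c.enc m s)
    -- Rewarding the decoding region of m by log ν gains the success probability times log ν and
    -- costs at most ν times the reference mass of that region.
    have g := sum_mul_add_sum_sub_le_relEntropy hp.1 hqm.1 (memoryless_absCont hac (c.enc m s))
      fun y => if c.dec y s = m then Real.log ν else 0
    rw [hq, relEntropy_memoryless hW hac, hp.2, ← hq] at g
    have e1 : 1 - ∑ y with c.dec y s ≠ m, memoryless W (c.enc m s) y =
        ∑ y with c.dec y s = m, memoryless W (c.enc m s) y := by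
      rw [← hp.2, ← Finset.sum_filter_add_sum_filter_not Finset.univ (fun y => c.dec y s = m)]
      simp
    have e2 : ∑ y, memoryless W (c.enc m s) y * (if c.dec y s = m then Real.log ν else 0) =
        (∑ y with c.dec y s = m, memoryless W (c.enc m s) y) * Real.log ν := by
      rw [Finset.sum_mul, Finset.sum_filter]
      exact Finset.sum_congr rfl fun y _ => by split_ifs <;> simp
    have e3 : ∑ y, q y * Real.exp (if c.dec y s = m then Real.log ν else 0) ≤
        1 + ν * (∑ y with c.dec y s = m, q y) := by
      rw [← hqm.2, Finset.mul_sum, Finset.sum_filter, ← Finset.sum_add_distrib]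
      refine Finset.sum_le_sum fun y _ => ?_
      have := hqm.1 y
      split_ifs
      · rw [Real.exp_log hν']; linarith
      · simp
    rw [e1]
    rw [e2] at g
    linarith
  have h2 : (1 / (ν : ℝ)) * ∑ m, ∑ s, c.keyDist s *
      ((1 - ∑ y with c.dec y s ≠ m, memoryless W (c.enc m s) y) * Real.log ν
        - ν * (∑ y with c.dec y s = m, q y)) ≤ c.expSum fun x => relEntropy (W x) (W x₀) :=
    mul_le_mul_of_nonneg_left (Finset.sum_le_sum fun m _ => Finset.sum_le_sum fun s _ =>
      mul_le_mul_of_nonneg_left (h1 m s) (c.keyDist_mem.1 s)) (by positivity)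
  refine le_trans (le_of_eq ?_) h2
  -- For a fixed key the decoding regions partition the output space, so the average cost is exactly
  -- 1.
  have h3 : ∑ m, ∑ s, c.keyDist s * (ν * (∑ y with c.dec y s = m, q y)) = ν := by
    rw [Finset.sum_comm]
    have (s : Fin c.κ) : ∑ m, c.keyDist s * (ν * ∑ y with c.dec y s = m, q y) =
        c.keyDist s * ν := by
      rw [← Finset.mul_sum, ← Finset.mul_sum, Finset.sum_fiberwise, hqm.2, mul_one]
    simp only [this]
    rw [← Finset.sum_mul, c.keyDist_mem.2, one_mul]
  simp only [mul_sub, Finset.sum_sub_distrib, sub_mul, one_mul]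
  rw [h3, c.average_const hν, Code.errorProb, one_div, inv_mul_cancel₀ hν'.ne']
  simp only [← mul_assoc, ← Finset.sum_mul]

end Code

/-! ### Single-letter converse for the covert capacity. -/

section covertRate

variable {X Y Z : Type*} [Fintype X] [DecidableEq X] [Fintype Y] [Fintype Z]

/-- `χ₂` of the output of a pmf on the nonzero symbols. -/
noncomputable def chiOut (V : X → Z → ℝ) (x₀ : X) (P : {x : X // x ≠ x₀} → ℝ) : ℝ :=
  chiSq (output P fun x => V x) (V x₀)

/-- The average divergence from the output of the zero symbol. -/
noncomputable def divAvg (W : X → Y → ℝ) (x₀ : X) (P : {x : X // x ≠ x₀} → ℝ) : ℝ :=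
  ∑ x, P x * relEntropy (W x) (W x₀)

/-- The covert rate of a pmf on the nonzero symbols. -/
noncomputable def covertRate (W : X → Y → ℝ) (V : X → Z → ℝ) (x₀ : X)
    (P : {x : X // x ≠ x₀} → ℝ) : ℝ :=
  Real.sqrt (2 / chiOut V x₀ P) * divAvg W x₀ P

theorem divAvg_nonneg {W : X → Y → ℝ} {x₀ : X} (hW : IsChannel W)
    (hac : ∀ x, AbsCont (W x) (W x₀)) {P : {x : X // x ≠ x₀} → ℝ}
    (hP : P ∈ stdSimplex ℝ _) : 0 ≤ divAvg W x₀ P :=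
  Finset.sum_nonneg fun x _ => mul_nonneg (hP.1 x) (relEntropy_nonneg (hW _) (hW _) (hac _))

theorem chiSq_pos_of_ne {p q : Z → ℝ} (hq : ∀ z, 0 ≤ q z) (hpq : AbsCont p q) (hne : p ≠ q) :
    0 < chiSq p q := by
  obtain ⟨z, hz⟩ := Function.ne_iff.1 hne
  refine Finset.sum_pos' (fun z _ => div_nonneg (sq_nonneg _) (hq z)) ⟨z, Finset.mem_univ z, ?_⟩
  have h0 : q z ≠ 0 := fun h => hz ((hpq z h).trans h.symm)
  have := (hq z).lt_of_ne' h0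
  have := sub_ne_zero.2 hz
  positivity

omit [Fintype Z] in
theorem output_mem_convexHull {V : X → Z → ℝ} {x₀ : X} {P : {x : X // x ≠ x₀} → ℝ}
    (hP : P ∈ stdSimplex ℝ _) :
    output P (fun x => V x) ∈ convexHull ℝ (V '' {x | x ≠ x₀}) := by
  have h : output P (fun x => V x) = ∑ x, P x • V x := by
    ext z
    simp [output]
  rw [h]
  exact (convex_convexHull ℝ _).sum_mem (fun x _ => hP.1 x) hP.2
    fun x _ => subset_convexHull ℝ _ ⟨x, x.2, rfl⟩

omit [Fintype X] [DecidableEq X] in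
-- Nonredundancy makes p differ from Q₀, and absolute continuity passes to the hull because p z = 0
-- is a convex condition.
theorem chiSq_pos_of_mem_convexHull {V : X → Z → ℝ} {x₀ : X} (hV : IsChannel V)
    (hac : ∀ x, AbsCont (V x) (V x₀)) (hn : V x₀ ∉ convexHull ℝ (V '' {x | x ≠ x₀}))
    {p : Z → ℝ} (hp : p ∈ convexHull ℝ (V '' {x | x ≠ x₀})) : 0 < chiSq p (V x₀) := by
  refine chiSq_pos_of_ne (hV x₀).1 (fun z hz => ?_) fun h => hn (h ▸ hp)
  have hc : Convex ℝ {p : Z → ℝ | p z = 0} := by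
    intro a ha b hb s t _ _ _
    simp_all
  exact convexHull_min (s := V '' {x | x ≠ x₀}) (by rintro _ ⟨x, -, rfl⟩; exact hac x z hz) hc hp

theorem continuous_chiOut (V : X → Z → ℝ) (x₀ : X) : Continuous (chiOut V x₀) := by
  unfold chiOut chiSq output
  fun_prop

/-- Attainment matters: the maximiser itself is later a witness for the computable region, of which
no closure is taken. -/
theorem exists_isMaxOn_covertRate [Nontrivial X] (W : X → Y → ℝ) {V : X → Z → ℝ} {x₀ : X}
    (hpos : ∀ P ∈ stdSimplex ℝ {x : X // x ≠ x₀}, 0 < chiOut V x₀ P) :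
    ∃ P ∈ stdSimplex ℝ {x : X // x ≠ x₀}, IsMaxOn (covertRate W V x₀) (stdSimplex ℝ _) P := by
  obtain ⟨x₁, hx₁⟩ := exists_ne x₀
  have : Nonempty {x : X // x ≠ x₀} := ⟨⟨x₁, hx₁⟩⟩
  refine (isCompact_stdSimplex ℝ _).exists_isMaxOn ⟨_, single_mem_stdSimplex ℝ ⟨x₁, hx₁⟩⟩ ?_
  unfold covertRate
  refine ContinuousOn.mul (ContinuousOn.sqrt
    (continuousOn_const.div (continuous_chiOut V x₀).continuousOn fun P hP => (hpos P hP).ne')) ?_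
  unfold divAvg
  fun_prop

/-- The letter law varies with the code and with n, so the error terms need a uniform bound. -/
theorem exists_chiOut_lower_bound [Nontrivial X] {V : X → Z → ℝ} {x₀ : X}
    (hpos : ∀ P ∈ stdSimplex ℝ {x : X // x ≠ x₀}, 0 < chiOut V x₀ P) :
    ∃ c > 0, ∀ P ∈ stdSimplex ℝ {x : X // x ≠ x₀}, c ≤ chiOut V x₀ P := by
  obtain ⟨x₁, hx₁⟩ := exists_ne x₀
  obtain ⟨P, hP, hm⟩ := (isCompact_stdSimplex ℝ _).exists_isMinOn
    ⟨_, single_mem_stdSimplex ℝ (⟨x₁, hx₁⟩ : {x : X // x ≠ x₀})⟩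
    (continuous_chiOut V x₀).continuousOn
  exact ⟨_, hpos P hP, fun P' hP' => hm hP'⟩

theorem exp_le_cubic {u : ℝ} (hu : |u| ≤ 1) : Real.exp u ≤ 1 + u + u ^ 2 / 2 + |u| ^ 3 := by
  have h := (abs_le.1 (Real.exp_bound hu (n := 3) (by norm_num))).2
  simp only [Finset.sum_range_succ, Finset.sum_range_zero, Nat.factorial] at h
  norm_num at h
  nlinarith [pow_nonneg (abs_nonneg u) 3]

/-- The tilting function that detects the signal `p` in the noise `q`. -/
noncomputable def relDev (p q : Z → ℝ) (z : Z) : ℝ := (p z - q z) / q z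

omit [Fintype Z] in
theorem sub_eq_mul_relDev {p q : Z → ℝ} (hpq : AbsCont p q) (z : Z) :
    p z - q z = q z * relDev p q z := by
  unfold relDev
  by_cases h : q z = 0
  · simp [h, hpq z h]
  · field_simp

theorem sum_sub_mul_relDev (p q : Z → ℝ) : ∑ z, (p z - q z) * relDev p q z = chiSq p q :=
  Finset.sum_congr rfl fun z _ => by unfold relDev; ring

/-- Under q the relative deviation has mean 0 and second moment χ₂, so this is a second-order
expansion with cubic remainder. -/
theorem log_sum_exp_relDev_le {p q : Z → ℝ} (hp : p ∈ stdSimplex ℝ Z) (hq : q ∈ stdSimplex ℝ Z)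
    (hpq : AbsCont p q) {H τ : ℝ} (hH : ∀ z, |relDev p q z| ≤ H) (hτ : 0 ≤ τ) (hτH : τ * H ≤ 1) :
    Real.log (∑ z, q z * Real.exp (τ * relDev p q z)) ≤ τ ^ 2 * chiSq p q / 2 + τ ^ 3 * H ^ 3 := by
  have h1 : ∑ z, q z * Real.exp (τ * relDev p q z) ≤
      1 + (τ ^ 2 * chiSq p q / 2 + τ ^ 3 * H ^ 3) := by
    have h2 : ∑ z, q z * relDev p q z = 0 := by
      simp only [← sub_eq_mul_relDev hpq, Finset.sum_sub_distrib, hp.2, hq.2, sub_self]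
    have h3 : ∑ z, q z * relDev p q z ^ 2 = chiSq p q := by
      rw [← sum_sub_mul_relDev]
      exact Finset.sum_congr rfl fun z _ => by rw [sub_eq_mul_relDev hpq]; ring
    have h4 : ∑ z, q z * (1 + τ * relDev p q z + τ ^ 2 / 2 * relDev p q z ^ 2 + τ ^ 3 * H ^ 3) =
        1 + (τ ^ 2 * chiSq p q / 2 + τ ^ 3 * H ^ 3) := by
      have (z : Z) : q z * (1 + τ * relDev p q z + τ ^ 2 / 2 * relDev p q z ^ 2 + τ ^ 3 * H ^ 3) =
        q z * (1 + τ ^ 3 * H ^ 3) + τ * (q z * relDev p q z) +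
          τ ^ 2 / 2 * (q z * relDev p q z ^ 2) := by ring
      simp only [this, Finset.sum_add_distrib, ← Finset.mul_sum, ← Finset.sum_mul, h2, h3, hq.2]
      ring
    rw [← h4]
    refine Finset.sum_le_sum fun z _ => mul_le_mul_of_nonneg_left ?_ (hq.1 z)
    have h5 : |τ * relDev p q z| ≤ τ * H := by
      rw [abs_mul, abs_of_nonneg hτ]
      exact mul_le_mul_of_nonneg_left (hH z) hτ
    have h6 := exp_le_cubic (h5.trans hτH)
    have h7 := pow_le_pow_left₀ (abs_nonneg _) h5 3
    calc _ ≤ _ := h6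
      _ ≤ 1 + τ * relDev p q z + (τ * relDev p q z) ^ 2 / 2 + (τ * H) ^ 3 := by linarith
      _ = _ := by ring
  have hpos := sum_mul_exp_pos hq fun z => τ * relDev p q z
  linarith [Real.log_le_sub_one_of_pos hpos]

/-- The bound does not depend on p. Where q vanishes, division by zero makes both quotients 0. -/
theorem abs_relDev_le {p q : Z → ℝ} (hp : p ∈ stdSimplex ℝ Z) (hq : q ∈ stdSimplex ℝ Z) (z : Z) :
    |relDev p q z| ≤ ∑ z, 1 / q z := by
  have h1 : |relDev p q z| ≤ 1 / q z := by
    unfold relDev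
    rw [abs_div, abs_of_nonneg (hq.1 z)]
    refine div_le_div_of_nonneg_right ?_ (hq.1 z)
    have a := (mem_Icc_of_mem_stdSimplex hp z)
    have b := (mem_Icc_of_mem_stdSimplex hq z)
    rw [abs_le]
    constructor <;> linarith [a.1, a.2, b.1, b.2]
  exact h1.trans (Finset.single_le_sum (f := fun z => 1 / q z)
    (fun z _ => one_div_nonneg.2 (hq.1 z)) (Finset.mem_univ z))

theorem sum_eq_sum_ne_of_eq_zero {x₀ : X} {f : X → ℝ} (h : f x₀ = 0) :
    ∑ x, f x = ∑ x : {x : X // x ≠ x₀}, f x := by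
  rw [← Fintype.sum_subtype_add_sum_subtype (fun x => x ≠ x₀) f]
  rw [add_eq_left]
  refine Finset.sum_eq_zero fun x _ => ?_
  rw [not_not.1 x.2, h]

omit [DecidableEq X] in
theorem output_mem_stdSimplex {V : X → Z → ℝ} (hV : IsChannel V) {P : X → ℝ}
    (hP : P ∈ stdSimplex ℝ X) : output P V ∈ stdSimplex ℝ Z := by
  refine ⟨fun z => Finset.sum_nonneg fun x _ => mul_nonneg (hP.1 x) ((hV x).1 z), ?_⟩
  unfold output
  rw [Finset.sum_comm]
  simp only [← Finset.mul_sum, (hV _).2, mul_one, hP.2]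

/-- Letter counts that satisfy the covertness inequalities carry limited divergence. -/
theorem sum_mul_relEntropy_le_of_covert {W : X → Y → ℝ} {V : X → Z → ℝ} {x₀ : X}
    (hW : IsChannel W) (hV : IsChannel V) (hWac : ∀ x, AbsCont (W x) (W x₀))
    (hVac : ∀ x, AbsCont (V x) (V x₀)) {c : ℝ} (hc : 0 < c)
    (hcle : ∀ P ∈ stdSimplex ℝ {x : X // x ≠ x₀}, c ≤ chiOut V x₀ P) {C : ℝ}
    (hC : ∀ P ∈ stdSimplex ℝ {x : X // x ≠ x₀}, covertRate W V x₀ P ≤ C) (hC0 : 0 ≤ C)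
    {δ : ℝ} (hδ : 0 < δ) {n : ℕ} (hn : 0 < n)
    (hnl : Real.sqrt (2 * δ / (n * c)) * (∑ z, 1 / V x₀ z) ≤ 1)
    {N : X → ℝ} (hN : ∀ x, 0 ≤ N x)
    (hcov : ∀ h : Z → ℝ, ∑ x, N x * ∑ z, V x z * h z ≤
      δ + n * Real.log (∑ z, V x₀ z * Real.exp (h z))) :
    ∑ x, N x * relEntropy (W x) (W x₀) ≤ Real.sqrt (n * δ) * C +
      2 * δ * (∑ z, 1 / V x₀ z) ^ 3 / c ^ 2 * ∑ x, relEntropy (W x) (W x₀) := by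
  set H := ∑ z, 1 / V x₀ z with hHdef
  have hH0 : 0 ≤ H := Finset.sum_nonneg fun z _ => one_div_nonneg.2 ((hV x₀).1 z)
  have hD (x : X) : 0 ≤ relEntropy (W x) (W x₀) := relEntropy_nonneg (hW _) (hW _) (hWac _)
  have hDs : 0 ≤ ∑ x, relEntropy (W x) (W x₀) := Finset.sum_nonneg fun x _ => hD x
  have hn' : (0 : ℝ) < n := by exact_mod_cast hn
  have hD0 : relEntropy (W x₀) (W x₀) = 0 := by
    refine Finset.sum_eq_zero fun y _ => ?_
    by_cases h : W x₀ y = 0 <;> simp [h]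
  rw [sum_eq_sum_ne_of_eq_zero (x₀ := x₀) (by rw [hD0, mul_zero])]
  set a := ∑ x : {x : X // x ≠ x₀}, N x with ha
  have ha0 : 0 ≤ a := Finset.sum_nonneg fun x _ => hN x
  rcases ha0.eq_or_lt with h0 | hapos
  · have hz : ∀ x : {x : X // x ≠ x₀}, N x = 0 := fun x =>
      (Finset.sum_eq_zero_iff_of_nonneg fun x _ => hN x.1).1 (ha.symm.trans h0.symm) x
        (Finset.mem_univ x)
    simp only [hz, zero_mul, Finset.sum_const_zero]
    positivity
  set P : {x : X // x ≠ x₀} → ℝ := fun x => N x / a with hPdef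
  have hP : P ∈ stdSimplex ℝ {x : X // x ≠ x₀} :=
    ⟨fun x => div_nonneg (hN x) ha0, by rw [hPdef, ← Finset.sum_div, ← ha, div_self hapos.ne']⟩
  have hNP (x : {x : X // x ≠ x₀}) : N x = a * P x := by rw [hPdef]; field_simp
  set p := output P fun x => V x with hp
  have hpm : p ∈ stdSimplex ℝ Z := output_mem_stdSimplex (V := fun x : {x : X // x ≠ x₀} => V x) (fun x => hV x) hP
  have hpq : AbsCont p (V x₀) := fun z hz =>
    Finset.sum_eq_zero fun x _ => by simp only [hVac x z hz, mul_zero]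
  set χ := chiOut V x₀ P with hχ
  have hχ' : chiSq p (V x₀) = χ := rfl
  have hcχ : c ≤ χ := hcle P hP
  have hχ0 : 0 < χ := hc.trans_le hcχ
  -- This τ minimises (δ + nτ²χ/2)/(τχ), the leading bound on a; the two numerator terms are then
  -- equal.
  set τ := Real.sqrt (2 * δ / (n * χ)) with hτ
  have hτ0 : 0 < τ := Real.sqrt_pos.2 (by positivity)
  have hτ2 : τ ^ 2 = 2 * δ / (n * χ) := Real.sq_sqrt (by positivity)
  have hτH : τ * H ≤ 1 := by
    refine le_trans (mul_le_mul_of_nonneg_right (Real.sqrt_le_sqrt ?_) hH0) hnl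
    gcongr
  have hlog := log_sum_exp_relDev_le hpm (hV x₀) hpq (abs_relDev_le hpm (hV x₀)) hτ0.le hτH
  have hc1 := hcov fun z => τ * relDev p (V x₀) z
  have hz : ∑ z, V x₀ z * relDev p (V x₀) z = 0 := by
    simp only [← sub_eq_mul_relDev hpq, Finset.sum_sub_distrib, hpm.2, (hV x₀).2, sub_self]
  -- The zero symbol drops out because the deviation has mean 0 under Q₀.
  have hleft : ∑ x, N x * ∑ z, V x z * (τ * relDev p (V x₀) z) = a * τ * χ := by
    rw [sum_eq_sum_ne_of_eq_zero (x₀ := x₀)]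
    · have : ∑ z, p z * relDev p (V x₀) z = χ := by
        have h := sum_sub_mul_relDev p (V x₀)
        simp only [sub_mul, Finset.sum_sub_distrib, hz, sub_zero] at h
        exact h
      rw [← this]
      simp only [hp, output, hNP, Finset.sum_mul, Finset.mul_sum]
      rw [Finset.sum_comm]
      exact Finset.sum_congr rfl fun z _ => Finset.sum_congr rfl fun x _ => by ring
    · have : ∑ z, V x₀ z * (τ * relDev p (V x₀) z) = τ * ∑ z, V x₀ z * relDev p (V x₀) z := by
        rw [Finset.mul_sum]
        exact Finset.sum_congr rfl fun z _ => by ring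
      rw [this, hz, mul_zero, mul_zero]
  rw [hleft] at hc1
  rw [hχ', ← hHdef] at hlog
  have hδ' : δ = n * (τ ^ 2 * χ / 2) := by rw [hτ2]; field_simp
  have hbound : a * (τ * χ) ≤ (n * τ + n * τ ^ 2 * H ^ 3 / χ) * (τ * χ) := by
    have h := mul_le_mul_of_nonneg_left hlog hn'.le
    have e : (n * τ + n * τ ^ 2 * H ^ 3 / χ) * (τ * χ) = n * (τ ^ 2 * χ / 2) +
      n * (τ ^ 2 * χ / 2 + τ ^ 3 * H ^ 3) := by field_simp; ring
    rw [e, ← hδ']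
    linarith
  have hα : a ≤ n * τ + n * τ ^ 2 * H ^ 3 / χ := le_of_mul_le_mul_right hbound (by positivity)
  have hsum : ∑ x : {x : X // x ≠ x₀}, N x * relEntropy (W x) (W x₀) = a * divAvg W x₀ P := by
    unfold divAvg
    rw [Finset.mul_sum]
    exact Finset.sum_congr rfl fun x _ => by rw [hNP]; ring
  have hd0 : 0 ≤ divAvg W x₀ P := divAvg_nonneg hW hWac hP
  have hd1 : divAvg W x₀ P ≤ ∑ x, relEntropy (W x) (W x₀) := by
    rw [sum_eq_sum_ne_of_eq_zero (x₀ := x₀) hD0]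
    exact Finset.sum_le_sum fun x _ =>
      mul_le_of_le_one_left (hD x) (mem_Icc_of_mem_stdSimplex hP x).2
  rw [hsum]
  have hnτ : n * τ = Real.sqrt (n * δ) * Real.sqrt (2 / χ) := by
    rw [← Real.sqrt_mul (by positivity)]
    refine (Real.sqrt_eq_iff_mul_self_eq (by positivity) (by positivity)).2 ?_ |>.symm
    have : (n * τ) * (n * τ) = n ^ 2 * τ ^ 2 := by ring
    rw [this, hτ2]
    field_simp
  -- Since nτ² = 2δ/χ, the cubic remainder stays bounded as n grows.
  have hrest : n * τ ^ 2 * H ^ 3 / χ ≤ 2 * δ * H ^ 3 / c ^ 2 := by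
    have : n * τ ^ 2 * H ^ 3 / χ = 2 * δ * H ^ 3 / χ ^ 2 := by rw [hτ2]; field_simp
    rw [this]
    gcongr
  calc a * divAvg W x₀ P ≤ (n * τ + n * τ ^ 2 * H ^ 3 / χ) * divAvg W x₀ P := by gcongr
    _ = Real.sqrt (n * δ) * covertRate W V x₀ P + n * τ ^ 2 * H ^ 3 / χ * divAvg W x₀ P := by
      rw [hnτ, covertRate]; ring
    _ ≤ _ := by
      gcongr
      exact hC P hP

theorem le_of_isAchievableRate [Nontrivial X] {W : X → Y → ℝ} {V : X → Z → ℝ} {x₀ : X}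
    (hW : IsChannel W) (hV : IsChannel V) (hWac : ∀ x, AbsCont (W x) (W x₀))
    (hVac : ∀ x, AbsCont (V x) (V x₀))
    (hpos : ∀ P ∈ stdSimplex ℝ {x : X // x ≠ x₀}, 0 < chiOut V x₀ P) {C : ℝ}
    (hC : ∀ P ∈ stdSimplex ℝ {x : X // x ≠ x₀}, covertRate W V x₀ P ≤ C) (hC0 : 0 ≤ C)
    {δ : ℝ} (hδ : 0 < δ) {L : ℝ} (hL : IsAchievableRate W V x₀ δ L) : L ≤ C := by
  obtain ⟨c, hc, hcle⟩ := exists_chiOut_lower_bound hpos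
  set H := ∑ z, 1 / V x₀ z with hH
  set K := 2 * δ * H ^ 3 / c ^ 2 * ∑ x, relEntropy (W x) (W x₀) with hK
  have hinf : Filter.Tendsto (fun n : ℕ => Real.sqrt (n * δ)) Filter.atTop Filter.atTop :=
    Real.tendsto_sqrt_atTop.comp (tendsto_natCast_atTop_atTop.atTop_mul_const hδ)
  have hsmall : ∀ᶠ n : ℕ in Filter.atTop, Real.sqrt (2 * δ / (n * c)) * H ≤ 1 := by
    have : Filter.Tendsto (fun n : ℕ => Real.sqrt (2 * δ / (n * c)) * H) Filter.atTop
        (nhds (Real.sqrt 0 * H)) :=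
      ((Real.continuous_sqrt.tendsto 0).comp (Filter.Tendsto.const_div_atTop
        (tendsto_natCast_atTop_atTop.atTop_mul_const hc) _)).mul_const H
    rw [Real.sqrt_zero, zero_mul] at this
    exact this.eventually_le_const one_pos
  -- One ε serves as both error probability and rate slack. After division by √(nδ), the constants
  -- `K` (covertness remainder) and 1 (Fano) vanish as n → ∞.
  have key : ∀ ε > 0, ε < 1 → (1 - ε) * (L - ε) ≤ C := by
    intro ε hε hε1
    have hlim : Filter.Tendsto (fun n : ℕ => C + (K + 1) / Real.sqrt (n * δ)) Filter.atTop
        (nhds (C + 0)) := (Filter.Tendsto.const_div_atTop hinf _).const_add C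
    rw [add_zero] at hlim
    refine ge_of_tendsto hlim ?_
    filter_upwards [hL ε hε ε hε, hsmall, Filter.eventually_gt_atTop 0] with n hcode hn hn0
    obtain ⟨ν, hν, code, herr, hac, hcov⟩ := hcode
    have hn' : (0 : ℝ) < n := by exact_mod_cast hn0
    have hν' : (0 : ℝ) < ν := (Real.exp_pos _).trans_le hν
    have hν0 : 0 < ν := by exact_mod_cast hν'
    have hs : 0 < Real.sqrt (n * δ) := Real.sqrt_pos.2 (by positivity)
    have h1 := code.log_card_le hν0 hW hWac
    have h2 := sum_mul_relEntropy_le_of_covert hW hV hWac hVac hc hcle hC hC0 hδ hn0 hn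
      code.letterCount_nonneg fun h =>
        (code.sum_letterCount_mul_le hν0 hV hac h).trans (by gcongr)
    have h3 : Real.sqrt (n * δ) * (L - ε) ≤ Real.log ν := (Real.le_log_iff_exp_le hν').2 hν
    have h4 : 0 ≤ Real.log ν := Real.log_natCast_nonneg ν
    have h5 : (1 - ε) * Real.log ν ≤ (1 - code.errorProb W) * Real.log ν := by gcongr
    have h6 : (1 - ε) * (Real.sqrt (n * δ) * (L - ε)) ≤ (1 - ε) * Real.log ν :=
      mul_le_mul_of_nonneg_left h3 (by linarith)
    rw [← sub_le_iff_le_add', le_div_iff₀ hs]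
    linarith
  have hlim : Filter.Tendsto (fun ε : ℝ => (1 - ε) * (L - ε)) (nhdsWithin 0 (Set.Ioi 0))
      (nhds ((1 - 0) * (L - 0))) := by
    refine Filter.Tendsto.mono_left (Continuous.tendsto ?_ 0) nhdsWithin_le_nhds
    fun_prop
  have := le_of_tendsto hlim (b := C) (by
    filter_upwards [Ioo_mem_nhdsGT (zero_lt_one (α := ℝ))] with ε hε
    exact key ε hε.1 hε.2)
  simpa using this

theorem covertCapacity_le [Nontrivial X] {W : X → Y → ℝ} {V : X → Z → ℝ} {x₀ : X}
    (hW : IsChannel W) (hV : IsChannel V) (hWac : ∀ x, AbsCont (W x) (W x₀))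
    (hVac : ∀ x, AbsCont (V x) (V x₀))
    (hpos : ∀ P ∈ stdSimplex ℝ {x : X // x ≠ x₀}, 0 < chiOut V x₀ P) {C : ℝ}
    (hC : ∀ P ∈ stdSimplex ℝ {x : X // x ≠ x₀}, covertRate W V x₀ P ≤ C) (hC0 : 0 ≤ C)
    {δ : ℝ} (hδ : 0 < δ) : covertCapacity W V x₀ δ ≤ ENNReal.ofReal C := by
  refine iSup₂_le fun L hL => ?_
  rw [← ENNReal.ofReal_coe_nnreal]
  exact ENNReal.ofReal_le_ofReal (le_of_isAchievableRate hW hV hWac hVac hpos hC hC0 hδ hL)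

end covertRate

/-! ### Time sharing inside the computable region. -/

section timeSharing

variable {X Y₁ Y₂ Y Z : Type*} [Fintype X] [DecidableEq X] [Fintype Y₁] [Fintype Y₂] [Fintype Y]
  [Fintype Z]

omit [Fintype X] [DecidableEq X] [Fintype Y₁] [Fintype Y₂] [Fintype Y] in
/-- Minkowski's inequality for `√χ₂`, in squared form. -/
theorem chiSq_mix_le {p₁ p₂ q : Z → ℝ} (hq : ∀ z, 0 ≤ q z) {s₁ s₂ : ℝ} (hs₁ : 0 < s₁)
    (hs₂ : 0 < s₂) (h₁ : chiSq p₁ q = s₁ ^ 2) (h₂ : chiSq p₂ q = s₂ ^ 2) {ν : ℝ} (hν0 : 0 ≤ ν)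
    (hν1 : ν ≤ 1) :
    chiSq (fun z => (1 - ν) * p₁ z + ν * p₂ z) q ≤ ((1 - ν) * s₁ + ν * s₂) ^ 2 := by
  have hν2 : 0 ≤ 1 - ν := by linarith
  -- The weights come from 2ab ≤ (s₂/s₁)a² + (s₁/s₂)b² applied to the cross term.
  set A := (1 - ν) ^ 2 + (1 - ν) * ν * (s₂ / s₁) with hA
  set B := ν ^ 2 + (1 - ν) * ν * (s₁ / s₂) with hB
  have e : ((1 - ν) * s₁ + ν * s₂) ^ 2 = A * chiSq p₁ q + B * chiSq p₂ q := by
    rw [h₁, h₂, hA, hB]; field_simp; ring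
  rw [e]
  unfold chiSq
  rw [Finset.mul_sum, Finset.mul_sum, ← Finset.sum_add_distrib]
  refine Finset.sum_le_sum fun z _ => ?_
  rw [← mul_div_assoc, ← mul_div_assoc, ← add_div]
  refine div_le_div_of_nonneg_right ?_ (hq z)
  set a := p₁ z - q z
  set b := p₂ z - q z
  have e1 : (1 - ν) * p₁ z + ν * p₂ z - q z = (1 - ν) * a + ν * b := by ring
  rw [e1]
  have e2 : A * a ^ 2 + B * b ^ 2 - ((1 - ν) * a + ν * b) ^ 2 =
      (1 - ν) * ν * ((s₂ * a - s₁ * b) ^ 2 / (s₁ * s₂)) := by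
    rw [hA, hB]; field_simp; ring
  have : 0 ≤ (1 - ν) * ν * ((s₂ * a - s₁ * b) ^ 2 / (s₁ * s₂)) := by positivity
  linarith

/-- The law of `(e X, X)` when `X` has pmf `P` on the nonzero symbols. -/
noncomputable def copyLaw {U : Type*} [DecidableEq U] {x₀ : X} (e : X ≃ U)
    (P : {x : X // x ≠ x₀} → ℝ) (ux : U × X) : ℝ :=
  if ux.1 = e ux.2 then (if h : ux.2 ≠ x₀ then P ⟨ux.2, h⟩ else 0) else 0

section copyLaw

variable {U : Type*} [Fintype U] [DecidableEq U] {x₀ : X} (e : X ≃ U) (P : {x : X // x ≠ x₀} → ℝ)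

omit [Fintype X] in
theorem sum_copyLaw_fst (x : X) :
    ∑ u, copyLaw e P (u, x) = if h : x ≠ x₀ then P ⟨x, h⟩ else 0 := by
  unfold copyLaw
  dsimp only
  rw [Finset.sum_ite_eq' Finset.univ (e x), if_pos (Finset.mem_univ _)]

theorem sum_copyLaw_mul (φ : X → ℝ) :
    ∑ x, (∑ u, copyLaw e P (u, x)) * φ x = ∑ x : {x : X // x ≠ x₀}, P x * φ x := by
  simp only [sum_copyLaw_fst]
  rw [sum_eq_sum_ne_of_eq_zero (x₀ := x₀) (by simp)]
  exact Finset.sum_congr rfl fun x _ => by rw [dif_pos x.2]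

variable {P} in
theorem copyLaw_mem (hP : P ∈ stdSimplex ℝ {x : X // x ≠ x₀}) :
    copyLaw e P ∈ stdSimplex ℝ (U × X) := by
  refine ⟨fun ux => ?_, ?_⟩
  · unfold copyLaw
    split_ifs
    · exact hP.1 _
    · exact le_rfl
    · exact le_rfl
  · rw [Fintype.sum_prod_type_right]
    have h := sum_copyLaw_mul e P fun _ => 1
    simp only [mul_one, hP.2] at h
    exact h

/-- U determines X, so only one x survives for each u and every logarithm with nonzero weight is log
1. -/
theorem condMutualInfo_copyLaw (W : X → Y → ℝ) : condMutualInfo (copyLaw e P) W = 0 := by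
  unfold condMutualInfo
  refine Finset.sum_eq_zero fun u _ => Finset.sum_eq_zero fun x _ => Finset.sum_eq_zero
    fun y _ => ?_
  by_cases hu : u = e x
  · have h0 (x' : X) (hx : x' ≠ x) : copyLaw e P (u, x') = 0 := by
      unfold copyLaw
      rw [if_neg]
      dsimp only
      rw [hu]
      exact fun h => hx (e.injective h).symm
    rw [Fintype.sum_eq_single x h0, Fintype.sum_eq_single x fun x' hx => by rw [h0 x' hx, zero_mul]]
    by_cases hz : copyLaw e P (u, x) * W x y = 0
    · simp [hz]
    · rw [mul_comm (copyLaw e P (u, x)) (_ * _), div_self, Real.log_one, mul_zero]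
      exact mul_ne_zero hz (left_ne_zero_of_mul hz)
  · simp [copyLaw, hu]

end copyLaw

/-- Every time-sharing combination of two covert rates lies in the computable region. -/
theorem mem_computableRegion_of_timeSharing {W₁ : X → Y₁ → ℝ} {W₂ : X → Y₂ → ℝ} {V : X → Z → ℝ}
    {x₀ : X} (hW₁ : IsChannel W₁) (hW₂ : IsChannel W₂) (hV : IsChannel V)
    (hC : CovertConditions W₁ W₂ V x₀) {P₁ P₂ : {x : X // x ≠ x₀} → ℝ}
    (hP₁ : P₁ ∈ stdSimplex ℝ _) (hP₂ : P₂ ∈ stdSimplex ℝ _) {t : ℝ} (ht0 : 0 ≤ t) (ht1 : t ≤ 1)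
    {L : ℝ × ℝ} (h1 : 0 ≤ L.1) (h2 : 0 ≤ L.2) (hL₁ : L.1 ≤ t * covertRate W₁ V x₀ P₁)
    (hL₂ : L.2 ≤ (1 - t) * covertRate W₂ V x₀ P₂) : L ∈ computableRegion W₁ W₂ V x₀ := by
  have hpos {p : Z → ℝ} (hp : p ∈ convexHull ℝ (V '' {x | x ≠ x₀})) : 0 < chiSq p (V x₀) :=
    chiSq_pos_of_mem_convexHull hV hC.absCont_warden hC.nonredundant hp
  have hχ₁ : 0 < chiOut V x₀ P₁ := hpos (output_mem_convexHull hP₁)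
  have hχ₂ : 0 < chiOut V x₀ P₂ := hpos (output_mem_convexHull hP₂)
  set s₁ := Real.sqrt (chiOut V x₀ P₁) with hs₁
  set s₂ := Real.sqrt (chiOut V x₀ P₂) with hs₂
  have hs₁0 : 0 < s₁ := Real.sqrt_pos.2 hχ₁
  have hs₂0 : 0 < s₂ := Real.sqrt_pos.2 hχ₂
  have ht2 : 0 ≤ 1 - t := by linarith
  set T := t / s₁ + (1 - t) / s₂ with hT
  have hT0 : 0 < T := by
    rcases ht0.eq_or_lt with h | h
    · rw [hT, ← h]; simpa using hs₂0
    · have := div_pos h hs₁0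
      have := div_nonneg ht2 hs₂0.le
      linarith
  -- The weights 1 - ν and ν are proportional to t/s₁ and (1 - t)/s₂. Minkowski then bounds √χ₂ of
  -- the mixture by 1/T, and T cancels from both rates.
  set ν := (1 - t) / s₂ / T with hν
  have hν' : 1 - ν = t / s₁ / T := by
    rw [hν, eq_div_iff hT0.ne', sub_mul, div_mul_cancel₀ _ hT0.ne', hT]; ring
  have hν0 : 0 ≤ ν := by positivity
  have hν1 : ν ≤ 1 := by
    have : 0 ≤ 1 - ν := by rw [hν']; positivity
    linarith
  -- Removing u₀ = 0 leaves exactly enough letters for a copy of X.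
  have hcard : Fintype.card X = Fintype.card {u : Fin (Fintype.card X + 1) // u ≠ 0} := by
    rw [Fintype.card_subtype_compl]; simp
  set e := Fintype.equivOfCardEq hcard
  have hout : output (fun x => ∑ u, copyLaw e P₂ (u, x)) V = output P₂ fun x => V x := by
    ext z
    exact sum_copyLaw_mul e P₂ fun x => V x z
  have hmix : chiMix V x₀ P₁ (copyLaw e P₂) ν = chiSq (fun z => (1 - ν) *
      output P₁ (fun x => V x) z + ν * output P₂ (fun x => V x) z) (V x₀) := by
    rw [chiMix, hout]
  have hmixpos : 0 < chiMix V x₀ P₁ (copyLaw e P₂) ν := by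
    rw [hmix]
    exact hpos (convex_convexHull ℝ _ (output_mem_convexHull hP₁) (output_mem_convexHull hP₂)
      (by linarith) hν0 (by ring))
  have hmixle : chiMix V x₀ P₁ (copyLaw e P₂) ν ≤ (1 / T) ^ 2 := by
    rw [hmix]
    refine (chiSq_mix_le (hV x₀).1 hs₁0 hs₂0 (Real.sq_sqrt hχ₁.le).symm (Real.sq_sqrt hχ₂.le).symm
      hν0 hν1).trans_eq ?_
    rw [hν', hν]
    congr 1
    field_simp
    ring
  have hfac : Real.sqrt 2 * T ≤ Real.sqrt (2 / chiMix V x₀ P₁ (copyLaw e P₂) ν) := by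
    refine Real.le_sqrt_of_sq_le ?_
    rw [mul_pow, Real.sq_sqrt zero_le_two, le_div_iff₀ hmixpos]
    calc 2 * T ^ 2 * chiMix V x₀ P₁ (copyLaw e P₂) ν ≤ 2 * T ^ 2 * (1 / T) ^ 2 := by gcongr
      _ = 2 := by field_simp
  have hd₁ := divAvg_nonneg hW₁ hC.absCont_user₁ hP₁
  have hd₂ := divAvg_nonneg hW₂ hC.absCont_user₂ hP₂
  refine ⟨h1, h2, ν, ⟨hν0, hν1⟩, Fintype.card X + 1, le_rfl, 0, P₁, hP₁, copyLaw e P₂,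
    copyLaw_mem e hP₂, hmixpos, hL₁.trans ?_, hL₂.trans ?_⟩
  · rw [condMutualInfo_copyLaw, mul_zero, add_zero]
    refine le_trans (le_of_eq ?_) (mul_le_mul_of_nonneg_right hfac
      (mul_nonneg (by linarith) hd₁))
    rw [hν', covertRate, Real.sqrt_div zero_le_two, ← hs₁]
    field_simp
    rfl
  · rw [condMutualInfo_copyLaw, mul_zero, sub_zero, sum_copyLaw_mul]
    refine le_trans (le_of_eq ?_) (mul_le_mul_of_nonneg_right hfac (mul_nonneg hν0 hd₂))
    rw [hν, covertRate, Real.sqrt_div zero_le_two, ← hs₂]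
    field_simp
    rfl

/-- The weight t is the first quotient, and the second is at most 1 - t. -/
theorem exists_weight_of_mem_timeSharingRegion {A B : ℝ≥0∞} {C D : ℝ} (hC : 0 ≤ C)
    (hD : 0 ≤ D) (hA : A ≤ ENNReal.ofReal C) (hB : B ≤ ENNReal.ofReal D) {L : ℝ × ℝ}
    (hL : L ∈ timeSharingRegion A B) :
    ∃ t, 0 ≤ t ∧ t ≤ 1 ∧ L.1 ≤ t * C ∧ L.2 ≤ (1 - t) * D := by
  obtain ⟨h1, h2, h⟩ := hL
  set a := ENNReal.ofReal L.1 / A with ha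
  set b := ENNReal.ofReal L.2 / B with hb
  have key {a A : ℝ≥0∞} {l C : ℝ} (hC : 0 ≤ C) (ha : a = ENNReal.ofReal l / A)
      (hA : A ≤ ENNReal.ofReal C) (ha1 : a ≤ 1) : l ≤ a.toReal * C := by
    have hfin : a ≠ ⊤ := (ha1.trans_lt ENNReal.one_lt_top).ne
    -- A zero capacity is covered too: the quotient is finite, which forces the numerator to vanish.
    have hle : ENNReal.ofReal l ≤ a * A :=
      (ENNReal.div_le_iff_le_mul (.inr hfin)
        (.inl (hA.trans_lt ENNReal.ofReal_lt_top).ne)).1 ha.ge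
    have h' : ENNReal.ofReal l ≤ ENNReal.ofReal (a.toReal * C) := by
      rw [ENNReal.ofReal_mul ENNReal.toReal_nonneg, ENNReal.ofReal_toReal hfin]
      exact hle.trans (by gcongr)
    exact (ENNReal.ofReal_le_ofReal_iff (by positivity)).1 h'
  have ha1 : a ≤ 1 := le_self_add.trans h
  have hb1 : b ≤ 1 := le_add_self.trans h
  have hsum : a.toReal + b.toReal ≤ 1 := by
    rw [← ENNReal.toReal_add (ha1.trans_lt ENNReal.one_lt_top).ne
      (hb1.trans_lt ENNReal.one_lt_top).ne]
    exact ENNReal.toReal_le_of_le_ofReal zero_le_one (by simpa using h)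
  have hb0 : 0 ≤ b.toReal := ENNReal.toReal_nonneg
  refine ⟨a.toReal, ENNReal.toReal_nonneg, by linarith, key hC ha hA ha1,
    (key hD hb hB hb1).trans ?_⟩
  gcongr
  linarith

end timeSharing

end CovertBC

theorem mainTheorem3 {X Y₁ Y₂ Z : Type*} [Fintype X] [DecidableEq X] [Nontrivial X]
    [Fintype Y₁] [Fintype Y₂] [Fintype Z]
    (W₁ : X → Y₁ → ℝ) (W₂ : X → Y₂ → ℝ) (V : X → Z → ℝ) (x₀ : X)
    (hW₁ : CovertBC.IsChannel W₁) (hW₂ : CovertBC.IsChannel W₂) (hV : CovertBC.IsChannel V)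
    (hC : CovertBC.CovertConditions W₁ W₂ V x₀) (δ : ℝ) (hδ : 0 < δ) :
    CovertBC.timeSharingRegion (CovertBC.covertCapacity W₁ V x₀ δ)
        (CovertBC.covertCapacity W₂ V x₀ δ) ⊆
      CovertBC.computableRegion W₁ W₂ V x₀ := by
  intro L hL
  have hpos : ∀ P ∈ stdSimplex ℝ {x : X // x ≠ x₀}, 0 < CovertBC.chiOut V x₀ P := fun P hP =>
    CovertBC.chiSq_pos_of_mem_convexHull hV hC.absCont_warden hC.nonredundant
      (CovertBC.output_mem_convexHull hP)
  obtain ⟨P₁, hP₁, hm₁⟩ := CovertBC.exists_isMaxOn_covertRate W₁ hpos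
  obtain ⟨P₂, hP₂, hm₂⟩ := CovertBC.exists_isMaxOn_covertRate W₂ hpos
  have h₁ : 0 ≤ CovertBC.covertRate W₁ V x₀ P₁ :=
    mul_nonneg (Real.sqrt_nonneg _) (CovertBC.divAvg_nonneg hW₁ hC.absCont_user₁ hP₁)
  have h₂ : 0 ≤ CovertBC.covertRate W₂ V x₀ P₂ :=
    mul_nonneg (Real.sqrt_nonneg _) (CovertBC.divAvg_nonneg hW₂ hC.absCont_user₂ hP₂)
  obtain ⟨t, ht0, ht1, hL₁, hL₂⟩ := CovertBC.exists_weight_of_mem_timeSharingRegion h₁ h₂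
    (CovertBC.covertCapacity_le hW₁ hV hC.absCont_user₁ hC.absCont_warden hpos
      (fun P hP => hm₁ hP) h₁ hδ)
    (CovertBC.covertCapacity_le hW₂ hV hC.absCont_user₂ hC.absCont_warden hpos
      (fun P hP => hm₂ hP) h₂ hδ) hL
  exact CovertBC.mem_computableRegion_of_timeSharing hW₁ hW₂ hV hC hP₁ hP₂ ht0 ht1
    hL.1 hL.2.1 hL₁ hL₂
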